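/- Let $R$ be a Gorenstein local ring, that is, a commutative Noetherian local ring of finite injective dimension over itself. A finitely generated $R$-module is maximal Cohen-Macaulay if its depth is at least $\dim R$ (the zero module has depth $\infty$). Write $\underline{\mathrm{MCM}}(R)$ for the stable category: its objects are the maximal Cohen-Macaulay $R$-modules, and its morphisms are the elements of $\underline{\mathrm{Hom}}_R(M,N)=\mathrm{Hom}_R(M,N)/P(M,N)$, where $P(M,N)$ is the set of homomorphisms which factor through a (finitely generated) projective module. For a maximal Cohen-Macaulay module $M$ let $\underline{\mathrm{ann}}_R(M)=\mathrm{ann}_R\,\underline{\mathrm{End}}_R(M)$. For a natural number $m$ let $\mathfrak{CM}(m,R)$ be the set of isomorphism classes of objects of $\underline{\mathrm{MCM}}(R)$ with the coarsest topology in which all the sets $$\mathrm{cl}_m(M)=\{L : (\underline{\mathrm{ann}}_R L)^m\subseteq \underline{\mathrm{ann}}_R M\},\qquad M \in \mathrm{MCM}(R),$$ are closed. An $R$-order is a module-finite $R$-algebra which is maximal Cohen-Macaulay as an $R$-module; it is $n$-canonical if $\mathrm{Hom}_R(\Lambda,R)$ has projective dimension $n$ as a (left) $\Lambda$-module. Let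 $\Lambda$ be an $n$-canonical $R$-order of finite global dimension such that the structure map $R\to\Lambda$ is a split monomorphism of $R$-modules. Then the topological space $\mathfrak{CM}(m,R)$ is compact for every natural number $m\ge \mathrm{gldim}\,\Lambda+1$. -/

import Mathlib

universe u

open CategoryTheory

noncomputable section

namespace CohenMacaulaySpace

section Depth

variable (R : Type u) [CommRing R] [IsLocalRing R] (M : Type u) [AddCommGroup M] [Module R M]

open Classical in
/-- The depth of a module over a local ring: the supremum of the lengths of the regular sequences
on `M` that consist of elements of the maximal ideal (a regular sequence `x₁, …, xₙ` satisfies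
`(x₁, …, xₙ) M ≠ M`). The zero module has depth `∞`. -/
def depth : ℕ∞ :=
  if Subsingleton M then ⊤
  else ⨆ rs ∈ {rs : List R | (∀ r ∈ rs, r ∈ IsLocalRing.maximalIdeal R) ∧
      RingTheory.Sequence.IsRegular M rs}, (rs.length : ℕ∞)

/-- A maximal Cohen-Macaulay module over a (Noetherian) local ring: a finitely generated module
whose depth is at least the Krull dimension of the ring. -/
structure IsMaximalCohenMacaulay : Prop where
  finite : Module.Finite R M
  ringKrullDim_le_depth : ringKrullDim R ≤ (depth R M : WithBot ℕ∞)

end Depth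

/-- A Gorenstein local ring: a commutative Noetherian local ring that has finite injective
dimension as a module over itself. -/
class IsGorensteinLocalRing (R : Type u) [CommRing R] : Prop extends
    IsLocalRing R, IsNoetherianRing R where
  injectiveDimension_ne_top : injectiveDimension (ModuleCat.of R R) ≠ ⊤

section StableHom

variable (R : Type u) [CommRing R]
variable (M N : Type u) [AddCommGroup M] [Module R M] [AddCommGroup N] [Module R N]

/-- `P(M, N)`: the submodule of `Hom_R(M, N)` of all homomorphisms which factor through a
(finitely generated) projective module. -/
def projHom : Submodule R (M →ₗ[R] N) where
  carrier := {f | ∃ (P : Type u) (_ : AddCommGroup P) (_ : Module R P),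
    Module.Finite R P ∧ Module.Projective R P ∧
      ∃ (α : M →ₗ[R] P) (β : P →ₗ[R] N), β ∘ₗ α = f}
  zero_mem' := ⟨PUnit, inferInstance, inferInstance, inferInstance, inferInstance, 0, 0, by simp⟩
  add_mem' := by
    rintro f g ⟨P, _, _, _, _, α, β, rfl⟩ ⟨Q, _, _, _, _, γ, δ, rfl⟩
    exact ⟨P × Q, inferInstance, inferInstance, inferInstance, inferInstance,
      α.prod γ, β.coprod δ, by ext; simp⟩
  smul_mem' := by
    rintro r f ⟨P, _, _, _, _, α, β, rfl⟩
    exact ⟨P, inferInstance, inferInstance, inferInstance, inferInstance,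
      α, r • β, by ext; simp⟩

/-- The stable Hom module `Hom_R(M, N) / P(M, N)`. -/
abbrev StableHom : Type u := (M →ₗ[R] N) ⧸ projHom R M N

/-- The stable annihilator of `M`: the annihilator in `R` of the stable endomorphism ring
of `M`. -/
def stableAnnihilator : Ideal R := Module.annihilator R (StableHom R M M)

variable {R M N}

lemma projHom_comp_left {L : Type u} [AddCommGroup L] [Module R L] {f : M →ₗ[R] N}
    (hf : f ∈ projHom R M N) (g : N →ₗ[R] L) : g ∘ₗ f ∈ projHom R M L := by
  obtain ⟨P, _, _, h₁, h₂, α, β, rfl⟩ := hf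
  exact ⟨P, inferInstance, inferInstance, h₁, h₂, α, g ∘ₗ β, rfl⟩

lemma projHom_comp_right {L : Type u} [AddCommGroup L] [Module R L] {f : M →ₗ[R] N}
    (hf : f ∈ projHom R M N) (g : L →ₗ[R] M) : f ∘ₗ g ∈ projHom R L N := by
  obtain ⟨P, _, _, h₁, h₂, α, β, rfl⟩ := hf
  exact ⟨P, inferInstance, inferInstance, h₁, h₂, α ∘ₗ g, β, rfl⟩

variable (R M N) in
/-- `M` and `N` are stably isomorphic, that is, isomorphic in the stable category, whose
morphisms are the elements of `Hom_R(M, N) / P(M, N)`. -/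
def StablyIsomorphic : Prop :=
  ∃ (f : M →ₗ[R] N) (g : N →ₗ[R] M),
    (Submodule.Quotient.mk (g ∘ₗ f) : StableHom R M M) = Submodule.Quotient.mk LinearMap.id ∧
    (Submodule.Quotient.mk (f ∘ₗ g) : StableHom R N N) = Submodule.Quotient.mk LinearMap.id

lemma mem_stableAnnihilator_iff (r : R) :
    r ∈ stableAnnihilator R M ↔ r • (LinearMap.id : M →ₗ[R] M) ∈ projHom R M M := by
  rw [stableAnnihilator, Module.mem_annihilator]
  constructor
  · intro h
    have := h (Submodule.Quotient.mk LinearMap.id)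
    rwa [← Submodule.Quotient.mk_smul, Submodule.Quotient.mk_eq_zero] at this
  · intro h x
    obtain ⟨f, rfl⟩ := Submodule.Quotient.mk_surjective _ x
    rw [← Submodule.Quotient.mk_smul, Submodule.Quotient.mk_eq_zero]
    have := projHom_comp_left h f
    rwa [LinearMap.comp_smul, LinearMap.comp_id] at this

lemma StablyIsomorphic.stableAnnihilator_le (h : StablyIsomorphic R M N) :
    stableAnnihilator R M ≤ stableAnnihilator R N := by
  obtain ⟨f, g, -, h⟩ := h
  intro r hr
  rw [mem_stableAnnihilator_iff] at hr ⊢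
  rw [Submodule.Quotient.eq] at h
  have h₁ := projHom_comp_left (projHom_comp_right hr g) f
  have h₂ := (projHom R N N).sub_mem h₁ ((projHom R N N).smul_mem r h)
  convert h₂ using 1
  ext x
  simp [smul_sub]

lemma StablyIsomorphic.symm (h : StablyIsomorphic R M N) : StablyIsomorphic R N M := by
  obtain ⟨f, g, h₁, h₂⟩ := h
  exact ⟨g, f, h₂, h₁⟩

lemma StablyIsomorphic.trans {L : Type u} [AddCommGroup L] [Module R L]
    (h : StablyIsomorphic R M N) (h' : StablyIsomorphic R N L) : StablyIsomorphic R M L := by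
  obtain ⟨f, g, h₁, h₂⟩ := h
  obtain ⟨f', g', h₃, h₄⟩ := h'
  rw [Submodule.Quotient.eq] at h₁ h₂ h₃ h₄
  refine ⟨f' ∘ₗ f, g ∘ₗ g', ?_, ?_⟩ <;> rw [Submodule.Quotient.eq]
  · have := (projHom R M M).add_mem (projHom_comp_left (projHom_comp_right h₃ f) g) h₁
    convert this using 1
    ext x
    simp
  · have := (projHom R L L).add_mem (projHom_comp_left (projHom_comp_right h₂ g') f') h₄
    convert this using 1
    ext x
    simp

end StableHom

section Space

variable (R : Type u) [CommRing R] [IsLocalRing R]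

/-- The objects of `MCM(R)`, which are also the objects of its stable category. -/
structure MCMModule : Type (u + 1) where
  carrier : Type u
  [addCommGroup : AddCommGroup carrier]
  [module : Module R carrier]
  isMCM : IsMaximalCohenMacaulay R carrier

attribute [instance] MCMModule.addCommGroup MCMModule.module

/-- Isomorphism in the stable category of maximal Cohen-Macaulay modules. -/
instance stableSetoid : Setoid (MCMModule R) where
  r M N := StablyIsomorphic R M.carrier N.carrier
  iseqv :=
    { refl := fun _ => ⟨LinearMap.id, LinearMap.id, rfl, rfl⟩
      symm := fun h => h.symm
      trans := fun h h' => h.trans h' }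

/-- The set of isomorphism classes of objects of the stable category of maximal Cohen-Macaulay
`R`-modules. The parameter `n` plays no role for the set; it selects the topology below. -/
def CM (_n : ℕ) : Type (u + 1) := Quotient (stableSetoid R)

variable {R} {n : ℕ}

/-- The stable annihilator of an isomorphism class. -/
def CM.ann (x : CM R n) : Ideal R :=
  Quotient.lift (fun M : MCMModule R => stableAnnihilator R M.carrier)
    (fun _ _ h => le_antisymm (StablyIsomorphic.stableAnnihilator_le h)
      (StablyIsomorphic.stableAnnihilator_le (StablyIsomorphic.symm h))) x

/-- `cl_n(M)`: all `L` such that the `n`-th power of the stable annihilator of `L` is contained in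
the stable annihilator of `M`. -/
def CM.cl (x : CM R n) : Set (CM R n) := {y | y.ann ^ n ≤ x.ann}

/-- The topology of `𝔠𝔐(n, R)`: the coarsest one in which all the sets `cl_n(M)` are closed. -/
instance : TopologicalSpace (CM R n) :=
  TopologicalSpace.generateFrom {U | ∃ x : CM R n, U = (CM.cl x)ᶜ}

end Space

section Orders

/-- An `R`-order: a module-finite `R`-algebra which is maximal Cohen-Macaulay as an `R`-module. -/
structure IsOrder (R : Type u) [CommRing R] [IsLocalRing R] (Λ : Type u) [Ring Λ] [Algebra R Λ] :
    Prop where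
  isMCM : IsMaximalCohenMacaulay R Λ

/-- The (left) global dimension of a ring: the supremum of the projective dimensions of its left
modules. -/
def globalDimension (Λ : Type u) [Ring Λ] : WithBot ℕ∞ :=
  ⨆ M : ModuleCat.{u} Λ, projectiveDimension M

variable (R : Type u) [CommRing R] (Λ : Type u) [Ring Λ] [Algebra R Λ]

/-- The canonical module `ω = Hom_R(Λ, R)` of an order over a Gorenstein local ring. -/
def CanonicalModule : Type u := Λ →ₗ[R] R

instance : AddCommGroup (CanonicalModule R Λ) := inferInstanceAs (AddCommGroup (Λ →ₗ[R] R))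

/-- The left `Λ`-module structure `(a • f)(x) = f(x a)` on `Hom_R(Λ, R)`. -/
instance : Module Λ (CanonicalModule R Λ) where
  smul a := fun f : Λ →ₗ[R] R => f ∘ₗ LinearMap.mulRight R a
  one_smul := fun f : Λ →ₗ[R] R => LinearMap.ext fun x => congrArg f (mul_one x)
  mul_smul a b := fun f : Λ →ₗ[R] R =>
    LinearMap.ext fun x => congrArg f (mul_assoc x a b).symm
  smul_zero _ := LinearMap.ext fun _ => rfl
  smul_add _ _ _ := LinearMap.ext fun _ => rfl
  add_smul a b := fun f : Λ →ₗ[R] R =>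
    LinearMap.ext fun x => (congrArg f (mul_add x a b)).trans (f.map_add (x * a) (x * b))
  zero_smul := fun f : Λ →ₗ[R] R =>
    LinearMap.ext fun x => (congrArg f (mul_zero x)).trans f.map_zero

/-- `Λ` is an `n`-canonical `R`-order: an `R`-order whose canonical module has projective
dimension `n` as a `Λ`-module. -/
structure IsCanonicalOrder [IsLocalRing R] (n : ℕ) : Prop extends IsOrder R Λ where
  projectiveDimension_eq :
    projectiveDimension (ModuleCat.of Λ (CanonicalModule R Λ)) = (n : WithBot ℕ∞)

/-- The structure map `R → Λ` is a split monomorphism of `R`-modules. -/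
def IsSplitStructureMap : Prop :=
  ∃ π : Λ →ₗ[R] R, π ∘ₗ Algebra.linearMap R Λ = LinearMap.id

end Orders

end CohenMacaulaySpace

end

namespace CohenMacaulaySpace

open Abelian IsLocalRing RingTheory.Sequence

/-! The class of `Λ` lies in every subbasic closed set, so the only open set containing it is the
whole space, and compactness follows. What must be shown is that the `m`-th power of the stable
annihilator of `Λ` lies in that of every maximal Cohen-Macaulay `M`.

An element of the stable annihilator of `Λ` kills positive `R`-extensions of projective `Λ`-modules.
Climbing a `Λ`-projective resolution costs one factor per step, so `m` factors kill `Ext_R` of any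
`Λ`-module in degrees at least `m`. This passes to every `R`-module `M`, a retract of `Λ ⊗ M`
(`smul_ext_eq_zero_of_isSplitStructureMap`).

For `M` maximal Cohen-Macaulay over a Gorenstein ring, `Ext^j(M, R) = 0` for `j > 0`, so dimension
shifting in the second variable brings the annihilation down to `Ext¹` (`smul_ext_one_eq_zero`).
Killing `Ext¹(M, ΩM)` makes `r • id` factor through a free module
(`mem_stableAnnihilator_of_smul_ext`). -/

lemma exists_natCast_eq {D : WithBot ℕ∞} (hbot : D ≠ ⊥) (htop : D ≠ ⊤) : ∃ d : ℕ, D = d := by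
  obtain ⟨D, rfl⟩ := WithBot.ne_bot_iff_exists.mp hbot
  obtain ⟨d, rfl⟩ := ENat.ne_top_iff_exists.mp (fun h : D = ⊤ ↦ htop (by rw [h]; rfl))
  exact ⟨d, rfl⟩

/-! ### Vanishing of Ext above the Krull dimension -/

section ExtVanishing

variable {R : Type u} [CommRing R]

section Exact

variable {A B C : Type u} [AddCommGroup A] [Module R A] [AddCommGroup B] [Module R B]
  [AddCommGroup C] [Module R C] {f : A →ₗ[R] B} {g : B →ₗ[R] C}

lemma shortExact_of_exact (hfg : Function.Exact f g) (hf : Function.Injective f)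
    (hg : Function.Surjective g) :
    (ModuleCat.shortComplexOfCompEqZero f g hfg.linearMap_comp_eq_zero).ShortExact :=
  ModuleCat.shortComplex_shortExact _ hfg hf hg

variable (N : ModuleCat.{u} R)

lemma subsingleton_ext_middle (hfg : Function.Exact f g) (hf : Function.Injective f)
    (hg : Function.Surjective g) (j : ℕ) (hA : Subsingleton (Ext (ModuleCat.of R A) N j))
    (hC : Subsingleton (Ext (ModuleCat.of R C) N j)) :
    Subsingleton (Ext (ModuleCat.of R B) N j) := by
  refine subsingleton_of_forall_eq 0 fun x ↦ ?_
  obtain ⟨y, rfl⟩ := Ext.contravariant_sequence_exact₂ (shortExact_of_exact hfg hf hg) N x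
    (hA.elim _ _)
  rw [hC.elim y 0, Ext.comp_zero]

lemma subsingleton_ext_left (hfg : Function.Exact f g) (hf : Function.Injective f)
    (hg : Function.Surjective g) (j : ℕ) (hB : Subsingleton (Ext (ModuleCat.of R B) N j))
    (hC : Subsingleton (Ext (ModuleCat.of R C) N (j + 1))) :
    Subsingleton (Ext (ModuleCat.of R A) N j) := by
  refine subsingleton_of_forall_eq 0 fun x ↦ ?_
  obtain ⟨y, rfl⟩ := Ext.contravariant_sequence_exact₁ (shortExact_of_exact hfg hf hg) N x
    (add_comm 1 j) (hC.elim _ _)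
  rw [hB.elim y 0, Ext.comp_zero]

end Exact

lemma subsingleton_ext_of_linearEquiv {A B : Type u} [AddCommGroup A] [Module R A]
    [AddCommGroup B] [Module R B] (e : A ≃ₗ[R] B) (N : ModuleCat.{u} R) (j : ℕ)
    (h : Subsingleton (Ext (ModuleCat.of R B) N j)) :
    Subsingleton (Ext (ModuleCat.of R A) N j) := by
  refine subsingleton_of_forall_eq 0 fun x ↦ ?_
  rw [← Ext.mk₀_id_comp x, ← e.toModuleIso.hom_inv_id, ← Ext.mk₀_comp_mk₀_assoc,
    h.elim ((Ext.mk₀ e.toModuleIso.inv).comp x (zero_add j)) 0, Ext.comp_zero]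

lemma subsingleton_ext_of_subsingleton {A : Type u} [AddCommGroup A] [Module R A]
    [Subsingleton A] (N : ModuleCat.{u} R) (j : ℕ) :
    Subsingleton (Ext (ModuleCat.of R A) N j) := by
  have := (ModuleCat.isZero_of_subsingleton (ModuleCat.of R A)).hasProjectiveDimensionLT_zero
  exact HasProjectiveDimensionLT.subsingleton _ 0 j (Nat.zero_le j) N

variable [IsLocalRing R]

lemma mem_maximalIdeal_of_isRegular {rs : List R} (hrs : IsRegular R rs) (r : R) (hr : r ∈ rs) :
    r ∈ maximalIdeal R := by
  by_contra hr'
  refine hrs.top_ne_smul (Eq.symm ?_)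
  rw [Ideal.eq_top_of_isUnit_mem (Ideal.ofList rs) (Ideal.subset_span hr)
    (by simpa using hr'), Submodule.top_smul]

variable [IsNoetherianRing R]

/-- If `x` is regular on `M`, the vanishing of `Ext(M / xM, N)` in one degree gives, by Nakayama,
the vanishing of `Ext(M, N)` in the preceding degree. -/
lemma subsingleton_ext_of_quotSMulTop {M : Type u} [AddCommGroup M] [Module R M]
    [Module.Finite R M] (N : ModuleCat.{u} R) [Module.Finite R N] {x : R}
    (hx : x ∈ maximalIdeal R) (reg : IsSMulRegular M x) (j : ℕ)
    (h : Subsingleton (Ext (ModuleCat.of R (QuotSMulTop x M)) N (j + 1))) :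
    Subsingleton (Ext (ModuleCat.of R M) N j) := by
  have hS := IsSMulRegular.smulShortComplex_shortExact (M := ModuleCat.of R M) reg
  by_contra hn
  rw [not_subsingleton_iff_nontrivial] at hn
  have hx' : x ∈ (Module.annihilator R (Ext (ModuleCat.of R M) N j)).jacobson :=
    maximalIdeal_le_jacobson _ hx
  -- Nakayama: the next term of the long exact sequence vanishes, so `x` acts surjectively on
  -- `Ext^j(M, N)`.
  refine Submodule.top_ne_pointwise_smul_of_mem_jacobson_annihilator hx' ?_
  rw [eq_comm, eq_top_iff]
  intro y _
  obtain ⟨z, hz⟩ := Ext.contravariant_sequence_exact₁ hS N y (add_comm 1 j) (h.elim _ _)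
  change Ext (ModuleCat.of R M) N j at z
  change (Ext.mk₀ (x • 𝟙 (ModuleCat.of R M))).comp z (zero_add j) = y at hz
  rw [Ext.mk₀_smul, Ext.smul_comp, Ext.mk₀_id_comp] at hz
  exact hz ▸ Submodule.smul_mem_pointwise_smul z x ⊤ trivial

/-- If `Ext^{j+1}(-, N)` vanishes on finitely generated modules and `Ext^j(k, N) = 0` for the
residue field `k`, then `Ext^j(-, N)` vanishes on finitely generated modules. -/
lemma subsingleton_ext_of_residueField (N : ModuleCat.{u} R) [Module.Finite R N] (j : ℕ)
    (hk : Subsingleton (Ext (ModuleCat.of R (R ⧸ maximalIdeal R)) N j))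
    (hj : ∀ (L : Type u) [AddCommGroup L] [Module R L] [Module.Finite R L],
      Subsingleton (Ext (ModuleCat.of R L) N (j + 1)))
    (L : Type u) [AddCommGroup L] [Module R L] [hL : Module.Finite R L] :
    Subsingleton (Ext (ModuleCat.of R L) N j) := by
  induction hL using IsNoetherianRing.induction_on_isQuotientEquivQuotientPrime R with
  | subsingleton N' => exact subsingleton_ext_of_subsingleton N j
  | quotient L' p e =>
    refine subsingleton_ext_of_linearEquiv e N j ?_
    -- If `p` is not maximal, any `x` in the maximal ideal outside `p` is regular on the domain `R ⧸
    -- p`.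
    by_cases hp : maximalIdeal R ≤ p.1
    · rwa [← (maximalIdeal.isMaximal R).eq_of_le p.2.ne_top hp]
    · obtain ⟨x, hx, hxp⟩ := SetLike.not_le_iff_exists.mp hp
      refine subsingleton_ext_of_quotSMulTop N hx ?_ j (hj _)
      refine isSMulRegular_iff_right_eq_zero_of_smul.mpr fun y hy ↦ ?_
      obtain ⟨y, rfl⟩ := Ideal.Quotient.mk_surjective y
      rw [← Ideal.Quotient.mk_eq_mk, ← Submodule.Quotient.mk_smul, smul_eq_mul,
        Submodule.Quotient.mk_eq_zero] at hy
      exact Ideal.Quotient.eq_zero_iff_mem.mpr ((p.2.mem_or_mem hy).resolve_left hxp)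
  | exact A B C f g hf hg hfg hA hC => exact subsingleton_ext_middle N hfg hf hg j hA hC

lemma length_le_ringKrullDim {rs : List R} (hrs : IsRegular R rs) :
    (rs.length : WithBot ℕ∞) ≤ ringKrullDim R := by
  rw [← ringKrullDim_add_length_eq_ringKrullDim_of_isRegular rs hrs]
  have : Nontrivial (R ⧸ Ideal.ofList rs) := Ideal.Quotient.nontrivial_iff.mpr fun h ↦
    hrs.top_ne_smul (by rw [h, Submodule.top_smul])
  exact le_add_of_nonneg_left ringKrullDim_nonneg_of_nontrivial

/-- A Noetherian local ring has a regular sequence whose quotient contains the residue field. -/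
lemma exists_isRegular_residueField_injective :
    ∃ (rs : List R), IsRegular R rs ∧
      ∃ f : (R ⧸ maximalIdeal R) →ₗ[R] (R ⧸ (Ideal.ofList rs • ⊤ : Submodule R R)),
        Function.Injective f := by
  by_contra! H
  -- The residue field is simple, so without an embedding there are no nonzero maps from it, and the
  -- maximal ideal then contains an element regular on the quotient. Regular sequences would grow
  -- beyond the finite Krull dimension.
  have ext_one (rs : List R) (hrs : IsRegular R rs) :
      ∃ x, IsRegular R (rs ++ [x]) := by
    have hsub : Subsingleton
        ((R ⧸ maximalIdeal R) →ₗ[R] (R ⧸ (Ideal.ofList rs • ⊤ : Submodule R R))) := by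
      refine subsingleton_of_forall_eq 0 fun f ↦ ?_
      have : IsSimpleModule R (R ⧸ maximalIdeal R) :=
        isSimpleModule_iff_isCoatom.mpr (maximalIdeal.isMaximal R).out
      exact (f.injective_or_eq_zero).resolve_left (H rs hrs f)
    obtain ⟨x, hx, hreg⟩ := IsSMulRegular.subsingleton_linearMap_iff.mp hsub
    rw [Ideal.annihilator_quotient] at hx
    refine ⟨x, _root_.RingTheory.Sequence.IsRegular.of_isWeaklyRegular_of_mem_maximalIdeal R (fun r hr ↦ ?_) ?_⟩
    · rcases List.mem_append.mp hr with hr | hr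
      · exact mem_maximalIdeal_of_isRegular hrs r hr
      · rwa [List.mem_singleton.mp hr]
    · rw [isWeaklyRegular_append_iff]
      exact ⟨hrs.toIsWeaklyRegular, by simpa [isWeaklyRegular_cons_iff] using! hreg⟩
  have all_lengths (n : ℕ) : ∃ rs : List R, IsRegular R rs ∧ rs.length = n := by
    induction n with
    | zero => exact ⟨[], IsRegular.nil R R, rfl⟩
    | succ n ih =>
      obtain ⟨rs, hrs, rfl⟩ := ih
      obtain ⟨x, hx⟩ := ext_one rs hrs
      exact ⟨_, hx, by simp⟩
  have hfin := ringKrullDim_lt_top (R := R)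
  have hle (n : ℕ) : (n : WithBot ℕ∞) ≤ ringKrullDim R := by
    obtain ⟨rs, hrs, rfl⟩ := all_lengths n
    exact length_le_ringKrullDim hrs
  obtain ⟨d, hd⟩ := exists_natCast_eq ringKrullDim_ne_bot hfin.ne
  have := hle (d + 1)
  rw [hd] at this
  norm_cast at this
  lia

/-- If `N` is finitely generated of finite injective dimension, then `Ext^j(-, N)` vanishes on
finitely generated modules for `j` larger than the Krull dimension. -/
lemma subsingleton_ext_of_ringKrullDim_lt (N : ModuleCat.{u} R) [Module.Finite R N] {e : ℕ}
    [hN : HasInjectiveDimensionLT N e] (j : ℕ) (hj : ringKrullDim R < j)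
    (L : Type u) [AddCommGroup L] [Module R L] [Module.Finite R L] :
    Subsingleton (Ext (ModuleCat.of R L) N j) := by
  obtain ⟨rs, hrs, f, hf⟩ := exists_isRegular_residueField_injective (R := R)
  have hlen : (rs.length : WithBot ℕ∞) ≤ ringKrullDim R := length_le_ringKrullDim hrs
  have hpd : projectiveDimension
      (ModuleCat.of R (R ⧸ (Ideal.ofList rs • ⊤ : Submodule R R))) < j := by
    have hmem : ∀ r ∈ rs, r ∈ maximalIdeal R := mem_maximalIdeal_of_isRegular hrs
    have h := ModuleCat.projectiveDimension_quotient_eq_add_length_of_isWeaklyRegular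
      (ModuleCat.of R R) rs hrs.toIsWeaklyRegular hmem
    rw [ModuleCat.projectiveDimension_eq_zero_of_projective (ModuleCat.of R R), zero_add] at h
    exact h.trans_lt (hlen.trans_lt hj)
  rw [projectiveDimension_lt_iff] at hpd
  -- Descending induction on `j`, starting where the injective dimension gives vanishing.
  obtain ⟨k, hk⟩ : ∃ k, e ≤ j + k := ⟨e, by lia⟩
  induction k generalizing j L with
  | zero => exact HasInjectiveDimensionLT.subsingleton N e j hk _
  | succ k ih =>
    have hsucc : ∀ (L : Type u) [AddCommGroup L] [Module R L] [Module.Finite R L],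
        Subsingleton (Ext (ModuleCat.of R L) N (j + 1)) := fun L _ _ _ ↦
      ih (j + 1) (hj.trans (by norm_cast; lia)) L
        (hasProjectiveDimensionLT_of_ge _ j (j + 1) (Nat.le_succ j)) (by lia)
    refine subsingleton_ext_of_residueField N j ?_ hsucc L
    -- `Ext^j` of the residue field sits between `Ext^j` of `R ⧸ (rs)`, zero by projective
    -- dimension, and `Ext^{j+1}` of the cokernel.
    exact subsingleton_ext_left N (LinearMap.exact_map_mkQ_range f) hf
      (Submodule.mkQ_surjective _) j (HasProjectiveDimensionLT.subsingleton _ j j le_rfl N)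
      (hsucc _)

/-- Each element of the sequence trades one degree through the Nakayama step. -/
lemma subsingleton_ext_of_isWeaklyRegular (N : ModuleCat.{u} R) [Module.Finite R N] (j : ℕ)
    (rs : List R) (hmem : ∀ r ∈ rs, r ∈ maximalIdeal R)
    (h : ∀ (L : Type u) [AddCommGroup L] [Module R L] [Module.Finite R L],
      Subsingleton (Ext (ModuleCat.of R L) N (j + rs.length)))
    (M : Type u) [AddCommGroup M] [Module R M] [Module.Finite R M] (hrs : IsWeaklyRegular M rs) :
    Subsingleton (Ext (ModuleCat.of R M) N j) := by
  induction rs generalizing j M with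
  | nil => exact h M
  | cons x rs ih =>
    rw [isWeaklyRegular_cons_iff] at hrs
    rw [List.forall_mem_cons] at hmem
    refine subsingleton_ext_of_quotSMulTop N hmem.1 hrs.1 j (ih (j + 1) hmem.2 ?_ _ hrs.2)
    rwa [List.length_cons, add_comm rs.length 1, ← add_assoc] at h

end ExtVanishing

/-! ### Maximal Cohen-Macaulay modules over Gorenstein rings -/

section Gorenstein

variable {R : Type u} [CommRing R]

/-- As `dim R` is a finite number, a supremum of lengths that is at least `dim R` forces one length
to be so. -/
lemma IsMaximalCohenMacaulay.exists_isRegular [IsLocalRing R] [IsNoetherianRing R]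
    {M : Type u} [AddCommGroup M] [Module R M] [Nontrivial M] (hM : IsMaximalCohenMacaulay R M) :
    ∃ rs : List R, (∀ r ∈ rs, r ∈ maximalIdeal R) ∧ IsWeaklyRegular M rs ∧
      ringKrullDim R ≤ rs.length := by
  obtain ⟨d, hd⟩ := exists_natCast_eq (D := ringKrullDim R) ringKrullDim_ne_bot
    ringKrullDim_lt_top.ne
  have h := hM.ringKrullDim_le_depth
  rw [hd, depth, if_neg (not_subsingleton M)] at h
  rw [hd]
  by_contra! H
  obtain _ | d := d
  · simpa using H [] (by simp) (IsWeaklyRegular.nil R M)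
  · have : (⨆ rs ∈ {rs : List R | (∀ r ∈ rs, r ∈ maximalIdeal R) ∧ IsRegular M rs},
        (rs.length : ℕ∞)) ≤ d := iSup₂_le fun rs hrs ↦ by
      have := H rs hrs.1 hrs.2.toIsWeaklyRegular
      norm_cast at this ⊢
      lia
    have h' : ((d + 1 : ℕ) : ℕ∞) ≤ d := le_trans (WithBot.coe_le_coe.mp h) this
    norm_cast at h'
    lia

/-- Over a Gorenstein local ring, maximal Cohen-Macaulay modules have no extensions by the
ring. -/
lemma IsMaximalCohenMacaulay.subsingleton_ext [IsGorensteinLocalRing R] {M : Type u}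
    [AddCommGroup M] [Module R M] (hM : IsMaximalCohenMacaulay R M) (j : ℕ) :
    Subsingleton (Ext (ModuleCat.of R M) (ModuleCat.of R R) (j + 1)) := by
  cases subsingleton_or_nontrivial M
  · exact subsingleton_ext_of_subsingleton _ _
  obtain ⟨e, he⟩ := (injectiveDimension_ne_top_iff _).mp
    (IsGorensteinLocalRing.injectiveDimension_ne_top (R := R))
  obtain ⟨rs, hmem, hrs, hdim⟩ := hM.exists_isRegular
  have := hM.finite
  refine subsingleton_ext_of_isWeaklyRegular (ModuleCat.of R R) (j + 1) rs hmem ?_ M hrs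
  refine subsingleton_ext_of_ringKrullDim_lt _ (e := e + 1) _ (hdim.trans_lt ?_)
  norm_cast
  lia

end Gorenstein

open TensorProduct

/-! ### Stable annihilators acting on Ext -/

section StableAnnihilator

variable {R : Type u} [CommRing R]

/-- If `r • id` factors through a projective module, then `r` kills all higher extensions. -/
lemma smul_ext_eq_zero_of_factors {M P : Type u} [AddCommGroup M] [Module R M] [AddCommGroup P]
    [Module R P] [Module.Projective R P] (α : M →ₗ[R] P) (β : P →ₗ[R] M) {r : R}
    (h : β ∘ₗ α = r • LinearMap.id) (N : ModuleCat.{u} R) {j : ℕ} (hj : j ≠ 0)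
    (x : Ext (ModuleCat.of R M) N j) : r • x = 0 := by
  obtain ⟨j, rfl⟩ := Nat.exists_eq_succ_of_ne_zero hj
  have hP : Projective (ModuleCat.of R P) := inferInstance
  have hr : r • 𝟙 (ModuleCat.of R M) = ModuleCat.ofHom α ≫ ModuleCat.ofHom β := by
    rw [← ModuleCat.ofHom_comp, h]
    rfl
  rw [← Ext.mk₀_id_comp x, ← Ext.smul_comp, ← Ext.mk₀_smul, hr, ← Ext.mk₀_comp_mk₀_assoc,
    Ext.eq_zero_of_projective ((Ext.mk₀ (ModuleCat.ofHom β)).comp x _), Ext.comp_zero]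

/-- If `r` kills the extensions of `M` by its first syzygy, then `r` lies in the stable annihilator
of `M`. -/
lemma mem_stableAnnihilator_of_smul_ext {M F : Type u} [AddCommGroup M] [Module R M]
    [AddCommGroup F] [Module R F] [Module.Finite R F] [Module.Projective R F] {g : F →ₗ[R] M}
    (hg : Function.Surjective g) {r : R}
    (h : ∀ x : Ext (ModuleCat.of R M) (ModuleCat.of R (LinearMap.ker g)) 1, r • x = 0) :
    r ∈ stableAnnihilator R M := by
  rw [mem_stableAnnihilator_iff]
  have hS := LinearMap.shortExact_shortComplexKer hg
  -- The obstruction to lifting `r • id` along `g` is `r` times the class of the syzygy extension,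
  -- hence zero.
  obtain ⟨y, hy⟩ := Ext.covariant_sequence_exact₃ (ModuleCat.of R M) hS
    (Ext.mk₀ (r • 𝟙 (ModuleCat.of R M))) (zero_add 1) (by
      rw [Ext.mk₀_smul, Ext.smul_comp, Ext.mk₀_id_comp]
      exact h _)
  obtain ⟨s, rfl⟩ := (Ext.mk₀_bijective _ _).2 y
  rw [Ext.mk₀_comp_mk₀] at hy
  have hy := (Ext.mk₀_bijective _ _).1 hy
  exact ⟨F, inferInstance, inferInstance, inferInstance, inferInstance, s.hom, g,
    congrArg ModuleCat.Hom.hom hy⟩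

variable {Λ : Type u} [Ring Λ] [Algebra R Λ]

/-- The stable annihilator of `Λ` kills the higher `R`-extensions of projective `Λ`-modules. -/
lemma smul_ext_eq_zero_of_projective {r : R} (hr : r ∈ stableAnnihilator R Λ) (X : Type u)
    [AddCommGroup X] [Module R X] [Module Λ X] [IsScalarTower R Λ X] [Module.Projective Λ X]
    (N : ModuleCat.{u} R) {j : ℕ} (hj : j ≠ 0) (x : Ext (ModuleCat.of R X) N j) : r • x = 0 := by
  obtain ⟨P, _, _, _, _, α, β, h⟩ := (mem_stableAnnihilator_iff r).mp hr
  obtain ⟨s, hs⟩ := Module.projective_def'.mp (inferInstance : Module.Projective Λ X)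
  let p : (X →₀ Λ) →ₗ[Λ] X := Finsupp.linearCombination Λ id
  have : Module.Projective R (X →₀ P) := by
    classical
    exact .of_equiv (finsuppLequivDFinsupp R).symm
  -- On `X`, `r • id` factors as `X → Λ^(X) → P^(X) → Λ^(X) → X`, with `P^(X)` projective over `R`.
  refine smul_ext_eq_zero_of_factors (P := X →₀ P)
    (Finsupp.mapRange.linearMap α ∘ₗ s.restrictScalars R)
    (p.restrictScalars R ∘ₗ Finsupp.mapRange.linearMap β) ?_ N hj x
  ext y
  have h₁ : Finsupp.mapRange.linearMap β (Finsupp.mapRange.linearMap α (s y)) = r • s y := by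
    ext z
    simpa using LinearMap.congr_fun h (s y z)
  have h₂ : p (s y) = y := LinearMap.congr_fun hs y
  have h₃ : p (r • s y) = r • p (s y) := (p.restrictScalars R).map_smul r (s y)
  change p (Finsupp.mapRange.linearMap β (Finsupp.mapRange.linearMap α (s y))) = r • y
  rw [h₁, h₃, h₂]

/-- If the `Λ`-module `X` has projective dimension less than `m`, then the `m`-th power of the
stable annihilator of `Λ` kills the `R`-extensions of `X` in degrees at least `m`. -/
lemma smul_ext_eq_zero_of_hasProjectiveDimensionLT (N : ModuleCat.{u} R) (m : ℕ) {r : R}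
    (hr : r ∈ stableAnnihilator R Λ ^ (m + 1)) (X : Type u)
    [AddCommGroup X] [Module R X] [Module Λ X] [IsScalarTower R Λ X]
    [hX : HasProjectiveDimensionLT (ModuleCat.of Λ X) (m + 1)]
    {j : ℕ} (hj : m < j) (x : Ext (ModuleCat.of R X) N j) : r • x = 0 := by
  induction m generalizing r X j with
  | zero =>
    rw [zero_add, ← projective_iff_hasProjectiveDimensionLT_one,
      ← IsProjective.iff_projective] at hX
    rw [zero_add, pow_one] at hr
    exact smul_ext_eq_zero_of_projective hr X N hj.ne' x
  | succ m ih =>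
    obtain ⟨j, rfl⟩ := Nat.exists_eq_succ_of_ne_zero (Nat.ne_zero_of_lt hj)
    let p : (X →₀ Λ) →ₗ[Λ] X := Finsupp.linearCombination Λ id
    have hp : Function.Surjective p := Finsupp.linearCombination_id_surjective Λ X
    have hpd : HasProjectiveDimensionLT (ModuleCat.of Λ (LinearMap.ker p)) (m + 1) :=
      ((LinearMap.shortExact_shortComplexKer hp).hasProjectiveDimensionLT_X₃_iff m
        (inferInstanceAs (Projective (ModuleCat.of Λ (X →₀ Λ))))).mp hX
    let ι : LinearMap.ker p →ₗ[R] (X →₀ Λ) := (LinearMap.ker p).subtype.restrictScalars R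
    have hex : Function.Exact ι (p.restrictScalars R) := LinearMap.exact_subtype_ker_map p
    have hsurj : Function.Surjective (p.restrictScalars R) := hp
    have hinj : Function.Injective ι := Submodule.subtype_injective (LinearMap.ker p)
    have hS := shortExact_of_exact (A := LinearMap.ker p) (f := ι) hex hinj hsurj
    rw [pow_succ] at hr
    induction hr using Submodule.mul_induction_on' with
    | add a _ b _ ha hb => rw [add_smul, ha, hb, add_zero]
    | mem_mul_mem a ha b hb =>
      -- The factor `b` kills the image of `x` in `Ext` of the free module, so `b • x` comes from
      -- the syzygy one degree lower, where `a` acts as zero.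
      obtain ⟨y, hy⟩ := Ext.contravariant_sequence_exact₃ hS N (b • x) (by
        rw [Ext.comp_smul]
        exact smul_ext_eq_zero_of_projective hb (X →₀ Λ) N j.succ_ne_zero _) (add_comm 1 j)
      have hy₀ : a • y = 0 := ih ha (LinearMap.ker p) (by lia) y
      rw [mul_smul, ← hy, ← Ext.comp_smul, hy₀, Ext.comp_zero]

lemma smul_ext_eq_zero_of_retract {M X : Type u} [AddCommGroup M] [Module R M] [AddCommGroup X]
    [Module R X] (i : M →ₗ[R] X) (p : X →ₗ[R] M) (h : p ∘ₗ i = LinearMap.id) {r : R}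
    {N : ModuleCat.{u} R} {j : ℕ} (hX : ∀ x : Ext (ModuleCat.of R X) N j, r • x = 0)
    (x : Ext (ModuleCat.of R M) N j) : r • x = 0 := by
  have h' : ModuleCat.ofHom i ≫ ModuleCat.ofHom p = 𝟙 (ModuleCat.of R M) := by
    rw [← ModuleCat.ofHom_comp, h]
    rfl
  rw [← Ext.mk₀_id_comp x, ← h', ← Ext.mk₀_comp_mk₀_assoc, ← Ext.comp_smul, hX, Ext.comp_zero]

/-- If `R` is a direct summand of `Λ` and all `Λ`-modules have projective dimension less than `m`,
then the `m`-th power of the stable annihilator of `Λ` kills all extensions in degrees at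
least `m`. -/
lemma smul_ext_eq_zero_of_isSplitStructureMap (hsplit : IsSplitStructureMap R Λ) {m : ℕ}
    (hΛ : ∀ X : ModuleCat.{u} Λ, HasProjectiveDimensionLT X (m + 1)) {r : R}
    (hr : r ∈ stableAnnihilator R Λ ^ (m + 1)) (M : Type u) [AddCommGroup M] [Module R M]
    (N : ModuleCat.{u} R) {j : ℕ} (hj : m < j) (x : Ext (ModuleCat.of R M) N j) : r • x = 0 := by
  obtain ⟨π, hπ⟩ := hsplit
  have := hΛ (ModuleCat.of Λ (Λ ⊗[R] M))
  -- The map `y ↦ 1 ⊗ y` has retraction `a ⊗ y ↦ π a • y`, since `π 1 = 1`.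
  refine smul_ext_eq_zero_of_retract (TensorProduct.mk R Λ M 1)
    (TensorProduct.lift ((LinearMap.lsmul R M).comp π)) ?_
    (smul_ext_eq_zero_of_hasProjectiveDimensionLT N m hr (Λ ⊗[R] M) hj) x
  ext y
  have : π 1 = 1 := by simpa using LinearMap.congr_fun hπ 1
  simp [this]

lemma subsingleton_ext_pi {M : ModuleCat.{u} R} {j : ℕ}
    (hM : Subsingleton (Ext M (ModuleCat.of R R) j)) (n : ℕ) :
    Subsingleton (Ext M (ModuleCat.of R (Fin n → R)) j) := by
  refine subsingleton_of_forall_eq 0 fun x ↦ ?_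
  have hid : 𝟙 (ModuleCat.of R (Fin n → R)) = ∑ i : Fin n,
      ModuleCat.ofHom (LinearMap.proj i) ≫ ModuleCat.ofHom (LinearMap.single R (fun _ ↦ R) i) := by
    ext : 1
    rw [ModuleCat.hom_sum]
    refine LinearMap.ext fun v ↦ ?_
    simpa using (Finset.univ_sum_single v).symm
  rw [← Ext.comp_mk₀_id x, hid, Ext.mk₀_sum, Ext.comp_sum]
  refine Finset.sum_eq_zero fun i _ ↦ ?_
  rw [← Ext.mk₀_comp_mk₀, ← Ext.comp_assoc_of_third_deg_zero,
    hM.elim (x.comp (Ext.mk₀ (ModuleCat.ofHom (LinearMap.proj i))) _) 0, Ext.zero_comp]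

/-- Dimension shifting: if the higher extensions of `M` by `R` vanish, and `r` kills the extensions
of `M` in degree `m + 1`, then `r` kills the first extensions of `M`. -/
lemma smul_ext_one_eq_zero [IsNoetherianRing R] {M : Type u} [AddCommGroup M] [Module R M]
    (hM : ∀ j, Subsingleton (Ext (ModuleCat.of R M) (ModuleCat.of R R) (j + 1))) {r : R} (m : ℕ)
    (h : ∀ (N : Type u) [AddCommGroup N] [Module R N] [Module.Finite R N]
      (x : Ext (ModuleCat.of R M) (ModuleCat.of R N) (m + 1)), r • x = 0)
    (N : Type u) [AddCommGroup N] [Module R N] [Module.Finite R N]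
    (x : Ext (ModuleCat.of R M) (ModuleCat.of R N) 1) : r • x = 0 := by
  induction m with
  | zero => exact h N x
  | succ m ih =>
    refine ih fun N _ _ _ x ↦ ?_
    obtain ⟨n, g, hg⟩ := Module.Finite.exists_fin' R N
    have hS := LinearMap.shortExact_shortComplexKer hg
    -- The connecting map sends `r • x` to zero by `h`, so it lifts to `Ext(M, R^n)`, which
    -- vanishes.
    obtain ⟨y, hy⟩ := Ext.covariant_sequence_exact₃ (ModuleCat.of R M) hS (r • x) rfl (by
      rw [Ext.smul_comp]
      exact h _ _)
    rw [← hy, (subsingleton_ext_pi (hM m) n).elim y 0, Ext.zero_comp]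

/-- Over a Gorenstein local ring, if `R` is a direct summand of `Λ` and all `Λ`-modules have
projective dimension at most `m`, then the `(m + 1)`-st power of the stable annihilator of `Λ` is
contained in that of every maximal Cohen-Macaulay module. -/
lemma stableAnnihilator_pow_le [IsGorensteinLocalRing R] (hsplit : IsSplitStructureMap R Λ) {m : ℕ}
    (hΛ : ∀ X : ModuleCat.{u} Λ, HasProjectiveDimensionLT X (m + 1)) {M : Type u} [AddCommGroup M]
    [Module R M] (hM : IsMaximalCohenMacaulay R M) :
    stableAnnihilator R Λ ^ (m + 1) ≤ stableAnnihilator R M := by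
  intro r hr
  have := hM.finite
  obtain ⟨n, g, hg⟩ := Module.Finite.exists_fin' R M
  exact mem_stableAnnihilator_of_smul_ext hg
    (smul_ext_one_eq_zero hM.subsingleton_ext m
      (fun N _ _ _ x ↦ smul_ext_eq_zero_of_isSplitStructureMap hsplit hΛ hr M _ m.lt_succ_self x) _)

/-- A point which lies in all the subbasic closed sets makes the space compact. -/
lemma compactSpace_of_forall_mem_cl [IsLocalRing R] {m : ℕ} (y : CM R m)
    (hy : ∀ x : CM R m, y ∈ CM.cl x) : CompactSpace (CM R m) := by
  -- No subbasic open set contains `y`; finite intersections and unions add no proper open set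
  -- around it.
  have huniv (U : Set (CM R m)) (hU : IsOpen U) (hyU : y ∈ U) : U = Set.univ := by
    induction hU with
    | basic U hU =>
      obtain ⟨x, rfl⟩ := hU
      exact absurd (hy x) hyU
    | univ => rfl
    | inter U V _ _ hU hV => rw [hU hyU.1, hV hyU.2, Set.univ_inter]
    | sUnion S _ hS =>
      obtain ⟨U, hUS, hyU⟩ := hyU
      exact Set.eq_univ_of_univ_subset ((hS U hUS hyU) ▸ Set.subset_sUnion_of_mem hUS)
  refine ⟨isCompact_of_finite_subcover fun {ι} U hU hcover ↦ ?_⟩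
  obtain ⟨i, hi⟩ := Set.mem_iUnion.mp (hcover (Set.mem_univ y))
  exact ⟨{i}, by simp [huniv (U i) (hU i) hi]⟩

end StableAnnihilator
end CohenMacaulaySpace

/-! ### Compactness -/

theorem corollary4p14 (R : Type u) [CommRing R] [CohenMacaulaySpace.IsGorensteinLocalRing R]
    (Λ : Type u) [Ring Λ] [Algebra R Λ] (n : ℕ)
    (hΛ : CohenMacaulaySpace.IsCanonicalOrder R Λ n)
    (hsplit : CohenMacaulaySpace.IsSplitStructureMap R Λ)
    (hfin : CohenMacaulaySpace.globalDimension Λ ≠ ⊤)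
    (m : ℕ) (hm : CohenMacaulaySpace.globalDimension Λ + 1 ≤ (m : WithBot ℕ∞)) :
    CompactSpace (CohenMacaulaySpace.CM R m) := by
  obtain ⟨π, hπ⟩ := id hsplit
  -- Nontriviality excludes global dimension `⊥`, so it is a natural number.
  have : Nontrivial Λ := by
    by_contra h
    rw [not_nontrivial_iff_subsingleton] at h
    have h₁ : π (algebraMap R Λ 1) = 1 := LinearMap.congr_fun hπ 1
    rw [Subsingleton.elim (algebraMap R Λ 1) 0, map_zero] at h₁
    exact zero_ne_one h₁
  have hle (X : ModuleCat.{u} Λ) :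
      projectiveDimension X ≤ CohenMacaulaySpace.globalDimension Λ :=
    le_iSup (fun X : ModuleCat.{u} Λ ↦ projectiveDimension X) X
  have hbot : CohenMacaulaySpace.globalDimension Λ ≠ ⊥ := fun h ↦ by
    have := hle (ModuleCat.of Λ Λ)
    rw [h, le_bot_iff, projectiveDimension_eq_bot_iff, ModuleCat.isZero_iff_subsingleton] at this
    exact not_subsingleton Λ this
  obtain ⟨d, hd⟩ := CohenMacaulaySpace.exists_natCast_eq hbot hfin
  rw [hd] at hm
  norm_cast at hm
  obtain ⟨m, rfl⟩ := Nat.exists_eq_succ_of_ne_zero (Nat.ne_zero_of_lt hm)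
  have hpd (X : ModuleCat.{u} Λ) : HasProjectiveDimensionLT X (m + 1) := by
    rw [← projectiveDimension_lt_iff]
    refine (hle X).trans_lt ?_
    rw [hd]
    exact_mod_cast hm
  -- The distinguished point is the class of `Λ` itself, an object because an order is maximal
  -- Cohen-Macaulay.
  refine CohenMacaulaySpace.compactSpace_of_forall_mem_cl (Quotient.mk _ ⟨Λ, hΛ.isMCM⟩) fun x ↦ ?_
  obtain ⟨M, rfl⟩ := Quotient.exists_rep x
  exact CohenMacaulaySpace.stableAnnihilator_pow_le hsplit hpd M.isMCM
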